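/- **Strong duality II.** Let $\mathcal X$ be a finite-dimensional Euclidean space with inner product $\langle\cdot,\cdot\rangle$, and let $\mathcal C\subseteq\mathcal X$ be a nonempty closed convex set with $0\notin\mathcal C$. Let $\kappa:\mathcal X\to\mathbb R\cup\{+\infty\}$ be a closed gauge, i.e. a nonnegative, positively homogeneous convex function with $\kappa(0)=0$ whose epigraph $\{(x,\mu)\in\mathcal X\times\mathbb R : \kappa(x)\le\mu\}$ is closed. Define the polar gauge $$\kappa^\circ(y)=\inf\{\mu>0 : \langle x,y\rangle\le\mu\,\kappa(x)\ \text{for all } x\in\mathcal X\}\qquad(\inf\emptyset=+\infty),$$ the antipolar set $$\mathcal C'=\{y\in\mathcal X : \langle y,x\rangle\ge 1\ \text{for all } x\in\mathcal C\},$$ and the optimal values of the primal and the gauge dual problem $$v_p=\inf_{x\in\mathcal C}\kappa(x),\qquad v_g=\inf_{y\in\mathcal C'}\kappa^\circ(y).$$ Write $\operatorname{dom} f=\{x : f(x)<+\infty\}$ and let $\operatorname{ri}$ denote the relative interior. If $$\operatorname{ri}\operatorname{dom}\kappa\cap\operatorname{ri}\mathcal C\neq\emptyset\qquad\text{and}\qquad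 \operatorname{ri}\operatorname{dom}\kappa^\circ\cap\operatorname{ri}\mathcal C'\neq\emptyset,$$ then $v_p\,v_g=1$ and both optimal values are attained: there are $x^*\in\mathcal C$ with $\kappa(x^*)=v_p$ and $y^*\in\mathcal C'$ with $\kappa^\circ(y^*)=v_g$. -/

import Mathlib

open scoped RealInnerProductSpace

noncomputable section

/-- The epigraph `{(x, μ) ∈ E × ℝ | f x ≤ μ}` of an extended-real-valued function. -/
def epigraph {E : Type*} (f : E → EReal) : Set (E × ℝ) :=
  {p | f p.1 ≤ (p.2 : EReal)}

/-- The effective domain `{x | f x < ∞}`. -/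
def effDomain {E : Type*} (f : E → EReal) : Set E :=
  {x | f x < ⊤}

/-- A gauge: a nonnegative, positively homogeneous, convex function `κ : E → ℝ ∪ {+∞}` that vanishes
at the origin. Convexity of an extended-real-valued function is convexity of its epigraph. -/
structure IsGauge {E : Type*} [NormedAddCommGroup E] [NormedSpace ℝ E] (κ : E → EReal) : Prop where
  nonneg : ∀ x, 0 ≤ κ x
  map_zero : κ 0 = 0
  map_smul : ∀ (t : ℝ) (x : E), 0 < t → κ (t • x) = (t : EReal) * κ x
  convex : Convex ℝ (epigraph κ)

/-- A function is closed if its epigraph is closed. -/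
def IsClosedFun {E : Type*} [TopologicalSpace E] (f : E → EReal) : Prop :=
  IsClosed (epigraph f)

/-- The polar `κ°(y) = inf {μ > 0 | ⟪x, y⟫ ≤ μ κ(x) for all x}` of a gauge, where `μ` ranges over
the positive reals and the infimum of the empty set is `+∞`. -/
def polarGauge {E : Type*} [NormedAddCommGroup E] [InnerProductSpace ℝ E] (κ : E → EReal) :
    E → EReal := fun y =>
  sInf ((fun μ : ℝ => (μ : EReal)) ''
    {μ : ℝ | 0 < μ ∧ ∀ x : E, ((⟪x, y⟫ : ℝ) : EReal) ≤ (μ : EReal) * κ x})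

/-- The antipolar `C' = {y | ⟪y, x⟫ ≥ 1 for all x ∈ C}`. -/
def antipolar {E : Type*} [NormedAddCommGroup E] [InnerProductSpace ℝ E] (C : Set E) : Set E :=
  {y | ∀ x ∈ C, 1 ≤ (⟪y, x⟫ : ℝ)}

/-- The optimal value of the problem of minimizing `f` over `S`. -/
def optValue {E : Type*} (f : E → EReal) (S : Set E) : EReal :=
  ⨅ x ∈ S, f x

/-- The optimal value of the problem of minimizing `f` over `S` is attained at a feasible point. -/
def IsAttained {E : Type*} (f : E → EReal) (S : Set E) : Prop :=
  ∃ x ∈ S, f x = optValue f S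

end

/-! Weak duality bounds `κ°(y) κ(x)` below by 1, so feasibility on both sides makes `v = v_p` real
and positive. `IsGauge.exists_inner_le` (Riesz extension of positive functionals) yields a linear
minorant `z` of `κ` with `z ≥ v` on `C`; then `z / v` lies in `C'` and has polar value at most `1 /
v`, so it solves the dual.

For the primal, the same lemma applied to `κ°`, `C'` and `1 / v` gives `w`. By the two bipolar
theorems, `κ (v w) ≤ v` and `v w ∈ C''`, so some `t v w` with `0 < t ≤ 1` lies in `C`; shrinking
does not raise `κ` above `v`. -/

/-! ### Linear minorants from conic extension -/

theorem exists_pos_add_smul_sub_mem_of_mem_intrinsicInterior {E : Type*} [NormedAddCommGroup E]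
    [NormedSpace ℝ E] {s : Set E} {x c : E} (hx : x ∈ intrinsicInterior ℝ s) (hc : c ∈ s) :
    ∃ ε : ℝ, 0 < ε ∧ x + ε • (x - c) ∈ s := by
  obtain ⟨y, hy, rfl⟩ := mem_intrinsicInterior.1 hx
  have hmem : ∀ t : ℝ, (y : E) + t • ((y : E) - c) ∈ affineSpan ℝ s := fun t => by
    have h := (affineSpan ℝ s).smul_vsub_vadd_mem t y.2 (subset_affineSpan ℝ s hc) y.2
    simpa [add_comm] using h
  let g : ℝ → affineSpan ℝ s := fun t => ⟨(y : E) + t • ((y : E) - c), hmem t⟩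
  have hg : Continuous g := by
    apply Continuous.subtype_mk
    fun_prop
  have hg0 : g 0 = y := by
    apply Subtype.ext
    simp [g]
  have hnhds : ∀ᶠ t in nhds (0 : ℝ), g t ∈ ((↑) ⁻¹' s : Set (affineSpan ℝ s)) := by
    apply hg.continuousAt.eventually_mem
    rw [hg0]
    exact mem_interior_iff_mem_nhds.1 hy
  obtain ⟨ε, hε, h⟩ := Metric.eventually_nhds_iff.1 hnhds
  refine ⟨ε / 2, by positivity, h (y := ε / 2) ?_⟩
  rw [Real.dist_eq, sub_zero, abs_of_pos (by positivity)]
  linarith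

/-- The cone of all `p` such that `p + t • (c, v) ∈ K` for some `t ≥ 0` and `c ∈ C`. -/
def differenceCone {E : Type*} [NormedAddCommGroup E] [NormedSpace ℝ E]
    (K : PointedCone ℝ (E × ℝ)) {C : Set E} (hC : Convex ℝ C) (hne : C.Nonempty) (v : ℝ) :
    PointedCone ℝ (E × ℝ) where
  carrier := {p | ∃ t : ℝ, 0 ≤ t ∧ ∃ c ∈ C, p + t • ((c, v) : E × ℝ) ∈ K}
  zero_mem' := by
    obtain ⟨c, hc⟩ := hne
    exact ⟨0, le_rfl, c, hc, by simp⟩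
  smul_mem' := by
    rintro r p ⟨t, ht, c, hc, h⟩
    refine ⟨r * t, mul_nonneg r.2 ht, c, hc, ?_⟩
    have h' := K.smul_mem r.2 h
    rwa [smul_add, smul_smul] at h'
  add_mem' := by
    rintro p q ⟨t, ht, c, hc, h⟩ ⟨u, hu, d, hd, h'⟩
    have hadd := K.add_mem h h'
    rcases (add_nonneg ht hu).eq_or_lt with h0 | hpos
    · obtain rfl : t = 0 := by linarith
      obtain rfl : u = 0 := by linarith
      exact ⟨0, le_rfl, c, hc, by simpa using hadd⟩
    · refine ⟨t + u, hpos.le, (t / (t + u)) • c + (u / (t + u)) • d,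
        hC hc hd (by positivity) (by positivity) (by field_simp), ?_⟩
      convert hadd using 1
      ext
      · simp only [Prod.fst_add, Prod.smul_fst, smul_add, smul_smul]
        rw [mul_div_cancel₀ _ hpos.ne', mul_div_cancel₀ _ hpos.ne']
        abel
      · simp only [Prod.snd_add, Prod.smul_snd, smul_eq_mul]
        ring

theorem mem_differenceCone {E : Type*} [NormedAddCommGroup E] [NormedSpace ℝ E]
    {K : PointedCone ℝ (E × ℝ)} {C : Set E} {hC : Convex ℝ C} {hne : C.Nonempty} {v : ℝ}
    {p : E × ℝ} : p ∈ differenceCone K hC hne v ↔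
      ∃ t : ℝ, 0 ≤ t ∧ ∃ c ∈ C, p + t • ((c, v) : E × ℝ) ∈ K := Iff.rfl

/-- Under the relative interior condition, the projection of the difference cone contains the
linear span of the two sets. -/
theorem exists_mem_differenceCone {E : Type*} [NormedAddCommGroup E] [NormedSpace ℝ E]
    {K : PointedCone ℝ (E × ℝ)} {C : Set E} (hC : Convex ℝ C) (hne : C.Nonempty) (v : ℝ)
    (hri : (intrinsicInterior ℝ (Prod.fst '' (K : Set (E × ℝ))) ∩
      intrinsicInterior ℝ C).Nonempty) {w : E}
    (hw : w ∈ Submodule.span ℝ (Prod.fst '' (K : Set (E × ℝ)) ∪ C)) :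
    ∃ μ : ℝ, (w, μ) ∈ differenceCone K hC hne v := by
  obtain ⟨a, haK, haC⟩ := hri
  set N := differenceCone K hC hne v
  have hKN : ∀ {p : E × ℝ}, p ∈ K → p ∈ N := fun {p} hp => by
    obtain ⟨c, hc⟩ := hne
    exact mem_differenceCone.2 ⟨0, le_rfl, c, hc, by simpa using hp⟩
  have hCN : ∀ {c : E}, c ∈ C → (-c, -v) ∈ N := fun {c} hc =>
    mem_differenceCone.2 ⟨1, zero_le_one, c, hc, by simp [← Prod.zero_eq_mk]⟩
  have hsmul : ∀ {r : ℝ} {p : E × ℝ}, 0 ≤ r → p ∈ N → r • p ∈ N := fun {r p} hr hp =>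
    N.smul_mem hr hp
  have hfst : ∀ {p : E × ℝ} {x : E}, p ∈ N → p.1 = x → ∃ μ : ℝ, (x, μ) ∈ N := by
    rintro p _ hp rfl
    exact ⟨p.2, hp⟩
  obtain ⟨⟨a', α⟩, haα, rfl⟩ := intrinsicInterior_subset haK
  have haC' := intrinsicInterior_subset haC
  -- Both signs are carried along because `N` is only a cone, while the span allows negative
  -- scalars.
  have key : (∃ μ : ℝ, (w, μ) ∈ N) ∧ ∃ μ : ℝ, (-w, μ) ∈ N := by
    induction hw using Submodule.span_induction with
    | mem x hx =>
      rcases hx with hx | hx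
      -- The segment from `x` to the common point `a` extends past `a` to `d = a + ε (a - x)`, so
      -- `-x = ε⁻¹ (d - (1 + ε) a)`, where `a` is used as a point of `C`.
      · obtain ⟨ε, hε, ⟨⟨d, δ⟩, hd, hde⟩⟩ :=
          exists_pos_add_smul_sub_mem_of_mem_intrinsicInterior haK hx
        obtain ⟨⟨x', ξ⟩, hxξ, rfl⟩ := hx
        refine ⟨⟨ξ, hKN hxξ⟩, ?_⟩
        have h1 := hsmul (inv_nonneg.2 hε.le)
          (N.add_mem (hKN hd) (hsmul (by positivity : 0 ≤ 1 + ε) (hCN haC')))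
        refine hfst h1 ?_
        simp only at hde
        simp only [Prod.smul_fst, Prod.fst_add, hde]
        rw [inv_smul_eq_iff₀ hε.ne']
        module
      · obtain ⟨ε, hε, hc⟩ := exists_pos_add_smul_sub_mem_of_mem_intrinsicInterior haC hx
        refine ⟨?_, ⟨-v, hCN hx⟩⟩
        have h1 := hsmul (inv_nonneg.2 hε.le)
          (N.add_mem (hCN hc) (hsmul (by positivity : 0 ≤ 1 + ε) (hKN haα)))
        refine hfst h1 ?_
        simp only [Prod.smul_fst, Prod.fst_add]
        rw [inv_smul_eq_iff₀ hε.ne']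
        module
    | zero => exact ⟨⟨0, N.zero_mem⟩, ⟨0, by simp [← Prod.zero_eq_mk]⟩⟩
    | add x y _ _ hx hy =>
      obtain ⟨⟨μ, h1⟩, ν, h2⟩ := hx
      obtain ⟨⟨μ', h1'⟩, ν', h2'⟩ := hy
      exact ⟨⟨μ + μ', N.add_mem h1 h1'⟩, ν + ν', by
        rw [neg_add]
        exact N.add_mem h2 h2'⟩
    | smul r x _ hx =>
      obtain ⟨⟨μ, h1⟩, ν, h2⟩ := hx
      rcases le_total 0 r with hr | hr
      · exact ⟨⟨r * μ, hsmul hr h1⟩, r * ν, by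
          rw [← smul_neg]
          exact hsmul hr h2⟩
      · have hr' : 0 ≤ -r := by linarith
        refine ⟨⟨-r * ν, ?_⟩, -r * μ, ?_⟩
        · have := hsmul hr' h2
          rwa [Prod.smul_mk, neg_smul_neg] at this
        · rw [← neg_smul]
          exact hsmul hr' h1
  exact key.1

/-- Existence of a dual solution: if `v` bounds the cone `K` from below over `C` and the relative
interiors meet, there is a linear minorant of `K` that is at least `v` on `C`. -/
theorem exists_inner_le_of_intrinsicInterior_inter {E : Type*} [NormedAddCommGroup E]
    [InnerProductSpace ℝ E] [FiniteDimensional ℝ E] {K : PointedCone ℝ (E × ℝ)} {C : Set E}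
    (hC : Convex ℝ C) (hK0 : ∀ μ : ℝ, ((0 : E), μ) ∈ K → 0 ≤ μ) {v : ℝ}
    (hv : ∀ c ∈ C, ∀ μ : ℝ, (c, μ) ∈ K → v ≤ μ)
    (hri : (intrinsicInterior ℝ (Prod.fst '' (K : Set (E × ℝ))) ∩
      intrinsicInterior ℝ C).Nonempty) :
    ∃ z : E, (∀ x : E, ∀ μ : ℝ, (x, μ) ∈ K → (⟪z, x⟫ : ℝ) ≤ μ) ∧ ∀ c ∈ C, v ≤ (⟪z, c⟫ : ℝ) := by
  have hne : C.Nonempty := hri.mono (Set.inter_subset_right.trans intrinsicInterior_subset)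
  set W := Submodule.span ℝ (Prod.fst '' (K : Set (E × ℝ)) ∪ C)
  obtain ⟨L, hL⟩ := W.exists_isCompl
  have hCW : C ⊆ W := fun c hc => Submodule.subset_span (Or.inr hc)
  have hKW : ∀ p ∈ K, p.1 ∈ W := fun p hp => Submodule.subset_span (Or.inl ⟨p, hp, rfl⟩)
  -- Including the complement `L` in the domain lets translations by the domain move every vector
  -- into the difference cone, even when `W` is proper.
  let f : (E × ℝ) →ₗ.[ℝ] ℝ :=
    ⟨L.prod ⊤, (LinearMap.snd ℝ E ℝ).comp (L.prod ⊤).subtype⟩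
  have hnonneg : ∀ p : f.domain, (p : E × ℝ) ∈ differenceCone K hC hne v → 0 ≤ f p := by
    rintro ⟨⟨n, r⟩, hn⟩ hp
    change 0 ≤ r
    obtain ⟨t, ht, c, hc, h⟩ := mem_differenceCone.1 hp
    have hnL : n ∈ L := hn.1
    have hnW : n ∈ W := by
      have h1 := W.sub_mem (hKW _ h) (W.smul_mem t (hCW hc))
      simpa using h1
    obtain rfl : n = 0 := Submodule.disjoint_def.1 hL.disjoint n hnW hnL
    rcases ht.eq_or_lt with rfl | ht
    · exact hK0 r (by simpa using h)
    · have h1 := K.smul_mem (inv_nonneg.2 ht.le) h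
      have h2 : (c, t⁻¹ * (r + t * v)) ∈ K := by
        convert h1 using 1
        refine Prod.ext ?_ rfl
        change c = t⁻¹ • (0 + t • c)
        rw [zero_add, inv_smul_smul₀ ht.ne']
      have h3 := hv c hc _ h2
      rw [inv_mul_eq_div, le_div_iff₀ ht] at h3
      linarith
  have hdense : ∀ y, ∃ p : f.domain, (p : E × ℝ) + y ∈ differenceCone K hC hne v := by
    rintro ⟨u, r⟩
    obtain ⟨w, hw, n, hn, rfl⟩ := Submodule.mem_sup.1
      (show u ∈ W ⊔ L from hL.sup_eq_top ▸ Submodule.mem_top)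
    obtain ⟨μ, hμ⟩ := exists_mem_differenceCone hC hne v hri hw
    refine ⟨⟨(-n, μ - r), L.neg_mem hn, trivial⟩, ?_⟩
    convert hμ using 1
    ext <;> simp
  obtain ⟨g, hgf, hg⟩ := riesz_extension (differenceCone K hC hne v) f hnonneg hdense
  have hg1 : g (0, 1) = 1 := hgf ⟨(0, 1), L.zero_mem, trivial⟩
  let φ : E →ₗ[ℝ] ℝ := -(g.comp (LinearMap.inl ℝ E ℝ))
  let z := (InnerProductSpace.toDual ℝ E).symm (LinearMap.toContinuousLinearMap φ)
  have hz : ∀ x, (⟪z, x⟫ : ℝ) = -g (x, 0) := fun x => by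
    simp [z, φ]
  have hgx : ∀ (x : E) (μ : ℝ), g (x, μ) = μ - (⟪z, x⟫ : ℝ) := fun x μ => by
    have : ((x, μ) : E × ℝ) = (x, 0) + μ • (0, 1) := by ext <;> simp
    rw [this, map_add, map_smul, hg1, hz]
    simp
    ring
  refine ⟨z, fun x μ hx => ?_, fun c hc => ?_⟩
  · obtain ⟨c, hc⟩ := hne
    have := hg (x, μ) (mem_differenceCone.2 ⟨0, le_rfl, c, hc, by simpa using hx⟩)
    rw [hgx] at this
    linarith
  · have := hg (-c, -v) (mem_differenceCone.2
      ⟨1, zero_le_one, c, hc, by simp [← Prod.zero_eq_mk]⟩)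
    rw [hgx, inner_neg_right] at this
    linarith

/-! ### Gauges and their polars -/

theorem le_of_forall_real_le {a b : EReal} (h : ∀ r : ℝ, b ≤ r → a ≤ r) : a ≤ b := by
  induction b with
  | bot =>
    refine ((EReal.eq_bot_iff_forall_lt a).2 fun r => ?_).le
    exact (h (r - 1) bot_le).trans_lt (by exact_mod_cast sub_one_lt r)
  | coe r => exact h r le_rfl
  | top => exact le_top

theorem image_fst_epigraph {E : Type*} (f : E → EReal) :
    Prod.fst '' epigraph f = effDomain f := by
  ext x
  constructor
  · rintro ⟨⟨x, μ⟩, h, rfl⟩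
    exact lt_of_le_of_lt h (EReal.coe_lt_top μ)
  · intro h
    obtain ⟨r, hr⟩ := EReal.lt_iff_exists_real_btwn.1 h
    exact ⟨(x, r), hr.1.le, rfl⟩

theorem IsGauge.smul_mem_epigraph {E : Type*} [NormedAddCommGroup E] [NormedSpace ℝ E]
    {κ : E → EReal} (hκ : IsGauge κ) {t : ℝ} (ht : 0 ≤ t) {p : E × ℝ} (hp : p ∈ epigraph κ) :
    t • p ∈ epigraph κ := by
  rcases ht.eq_or_lt with rfl | ht
  · simp [epigraph, hκ.map_zero]
  · change κ (t • p.1) ≤ ((t * p.2 : ℝ) : EReal)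
    rw [hκ.map_smul t p.1 ht, EReal.coe_mul]
    exact mul_le_mul_of_nonneg_left hp (by exact_mod_cast ht.le)

/-- The epigraph of a gauge as a pointed cone. -/
def IsGauge.epigraphCone {E : Type*} [NormedAddCommGroup E] [NormedSpace ℝ E]
    {κ : E → EReal} (hκ : IsGauge κ) : PointedCone ℝ (E × ℝ) where
  carrier := epigraph κ
  zero_mem' := by simp [epigraph, hκ.map_zero]
  smul_mem' := fun r _ hp => hκ.smul_mem_epigraph r.2 hp
  add_mem' := fun {p q} hp hq => by
    have h := hκ.smul_mem_epigraph zero_le_two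
      (hκ.convex hp hq (by norm_num : (0 : ℝ) ≤ 1 / 2) (by norm_num : (0 : ℝ) ≤ 1 / 2)
        (by norm_num))
    convert h using 1
    module

theorem IsGauge.mem_epigraphCone {E : Type*} [NormedAddCommGroup E] [NormedSpace ℝ E]
    {κ : E → EReal} (hκ : IsGauge κ) {x : E} {μ : ℝ} :
    (x, μ) ∈ hκ.epigraphCone ↔ κ x ≤ μ := Iff.rfl

theorem IsGauge.nonneg_of_le {E : Type*} [NormedAddCommGroup E] [NormedSpace ℝ E]
    {κ : E → EReal} (hκ : IsGauge κ) {x : E} {μ : ℝ} (h : κ x ≤ μ) : 0 ≤ μ := by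
  exact_mod_cast (hκ.nonneg x).trans h

/-- The inequalities are closed in `r`, so they pass to the infimum, including `r = 0`. Testing on
epigraph points avoids the product `0 * ⊤`. -/
theorem polarGauge_le_coe_iff {E : Type*} [NormedAddCommGroup E] [InnerProductSpace ℝ E]
    {κ : E → EReal} (hκ : IsGauge κ) {y : E} {r : ℝ} :
    polarGauge κ y ≤ r ↔ 0 ≤ r ∧ ∀ (x : E) (μ : ℝ), κ x ≤ μ → (⟪x, y⟫ : ℝ) ≤ r * μ := by
  constructor
  · intro h
    have key : ∀ r' : ℝ, r < r' → 0 < r' ∧ ∀ (x : E) (μ : ℝ), κ x ≤ μ → (⟪x, y⟫ : ℝ) ≤ r' * μ := by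
      intro r' hr'
      obtain ⟨_, ⟨m, ⟨hm, hmx⟩, rfl⟩, hlt⟩ :=
        sInf_lt_iff.1 (lt_of_le_of_lt h (EReal.coe_lt_coe_iff.2 hr'))
      have hlt' : m < r' := EReal.coe_lt_coe_iff.1 hlt
      refine ⟨hm.trans hlt', fun x μ hx => ?_⟩
      have h1 : ((⟪x, y⟫ : ℝ) : EReal) ≤ ((m * μ : ℝ) : EReal) := by
        rw [EReal.coe_mul]
        exact (hmx x).trans (mul_le_mul_of_nonneg_left hx (by exact_mod_cast hm.le))
      have h2 : (⟪x, y⟫ : ℝ) ≤ m * μ := by exact_mod_cast h1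
      exact h2.trans (mul_le_mul_of_nonneg_right hlt'.le (hκ.nonneg_of_le hx))
    refine ⟨le_of_forall_gt fun r' hr' => (key r' hr').1, fun x μ hx => ?_⟩
    have hmem : Set.Ioi r ⊆ {s : ℝ | (⟪x, y⟫ : ℝ) ≤ s * μ} := fun s hs => (key s hs).2 x μ hx
    have hcl : IsClosed {s : ℝ | (⟪x, y⟫ : ℝ) ≤ s * μ} :=
      isClosed_le continuous_const (by fun_prop)
    exact hcl.closure_subset_iff.2 hmem (by simp)
  · rintro ⟨hr, h⟩
    refine EReal.le_of_forall_lt_iff_le.1 fun s hs => ?_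
    have hrs : r < s := by exact_mod_cast hs
    refine sInf_le ⟨s, ⟨hr.trans_lt hrs, fun x => ?_⟩, rfl⟩
    generalize hk : κ x = k
    induction k with
    | bot => exact absurd (hκ.nonneg x) (by simp [hk])
    | coe μ =>
      rw [← EReal.coe_mul]
      have h1 := hκ.nonneg_of_le hk.le
      exact_mod_cast (h x μ hk.le).trans (mul_le_mul_of_nonneg_right hrs.le h1)
    | top => simp [EReal.coe_mul_top_of_pos (hr.trans_lt hrs)]

theorem isGauge_polarGauge {E : Type*} [NormedAddCommGroup E] [InnerProductSpace ℝ E]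
    {κ : E → EReal} (hκ : IsGauge κ) : IsGauge (polarGauge κ) := by
  have hle : ∀ (t : ℝ) (y : E), 0 < t → ∀ r : ℝ, polarGauge κ y ≤ r →
      polarGauge κ (t • y) ≤ (t * r : ℝ) := by
    intro t y ht r h
    obtain ⟨hr, h⟩ := (polarGauge_le_coe_iff hκ).1 h
    refine (polarGauge_le_coe_iff hκ).2 ⟨by positivity, fun x μ hx => ?_⟩
    rw [real_inner_smul_right, mul_assoc]
    exact mul_le_mul_of_nonneg_left (h x μ hx) ht.le
  have hnonneg : ∀ y, 0 ≤ polarGauge κ y := by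
    rintro y
    refine le_sInf ?_
    rintro _ ⟨μ, hμ, rfl⟩
    exact EReal.coe_nonneg.2 hμ.1.le
  refine ⟨hnonneg, ?_, fun t y ht => ?_, ?_⟩
  · refine le_antisymm ?_ (hnonneg 0)
    exact_mod_cast (polarGauge_le_coe_iff (r := 0) hκ).2 ⟨le_rfl, fun x μ _ => by simp⟩
  · refine le_antisymm (le_of_forall_real_le fun r hr => ?_)
      (le_of_forall_real_le fun r hr => ?_)
    · have h : polarGauge κ y ≤ ((t⁻¹ * r : ℝ) : EReal) := by
        have h1 := mul_le_mul_of_nonneg_left hr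
          (show (0 : EReal) ≤ ((t⁻¹ : ℝ) : EReal) by exact_mod_cast (inv_pos.2 ht).le)
        rwa [← mul_assoc, ← EReal.coe_mul, ← EReal.coe_mul, inv_mul_cancel₀ ht.ne',
          EReal.coe_one, one_mul] at h1
      have h2 := hle t y ht _ h
      rwa [mul_inv_cancel_left₀ ht.ne'] at h2
    · have h := hle t⁻¹ (t • y) (inv_pos.2 ht) r hr
      rw [inv_smul_smul₀ ht.ne'] at h
      have h1 := mul_le_mul_of_nonneg_left h
        (show (0 : EReal) ≤ (t : EReal) by exact_mod_cast ht.le)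
      rwa [← EReal.coe_mul, mul_inv_cancel_left₀ ht.ne'] at h1
  · rintro ⟨y, r⟩ hy ⟨z, s⟩ hz a b ha hb -
    obtain ⟨hr, hy⟩ := (polarGauge_le_coe_iff hκ).1 hy
    obtain ⟨hs, hz⟩ := (polarGauge_le_coe_iff hκ).1 hz
    refine (polarGauge_le_coe_iff hκ).2 ⟨by simp; positivity, fun x μ hx => ?_⟩
    simp only [Prod.fst_add, Prod.smul_fst, Prod.snd_add, Prod.smul_snd, smul_eq_mul,
      inner_add_right, real_inner_smul_right]
    have h1 := mul_le_mul_of_nonneg_left (hy x μ hx) ha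
    have h2 := mul_le_mul_of_nonneg_left (hz x μ hx) hb
    linarith

/-! ### Bipolar theorems -/

/-- The nontrivial half of the bipolar theorem for closed gauges. -/
theorem le_of_forall_inner_le_polarGauge {E : Type*} [NormedAddCommGroup E]
    [InnerProductSpace ℝ E] [CompleteSpace E] {κ : E → EReal} (hκ : IsGauge κ)
    (hcl : IsClosedFun κ) {x : E} {m : ℝ}
    (h : ∀ (y : E) (r : ℝ), polarGauge κ y ≤ r → (⟪x, y⟫ : ℝ) ≤ m * r) : κ x ≤ m := by
  by_contra hx
  let K : ProperCone ℝ (E × ℝ) := ⟨hκ.epigraphCone, hcl⟩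
  obtain ⟨g, hg, hgx⟩ := K.hyperplane_separation_point (x₀ := (x, m)) hx
  let y := (InnerProductSpace.toDual ℝ E).symm (-(g.comp (ContinuousLinearMap.inl ℝ E ℝ)))
  have hy : ∀ w, (⟪w, y⟫ : ℝ) = -g (w, 0) := fun w => by
    rw [real_inner_comm]
    simp [y]
  set s := g (0, 1) with hs
  have hgw : ∀ (w : E) (μ : ℝ), g (w, μ) = s * μ - (⟪w, y⟫ : ℝ) := fun w μ => by
    have : ((w, μ) : E × ℝ) = (w, 0) + μ • (0, 1) := by ext <;> simp
    rw [this, map_add, map_smul, hy, ← hs, smul_eq_mul]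
    ring
  have hepi : ∀ (w : E) (μ : ℝ), κ w ≤ μ → (⟪w, y⟫ : ℝ) ≤ s * μ := fun w μ hw => by
    have := hg (w, μ) hw
    rw [hgw] at this
    linarith
  -- A vertical hyperplane, `s = 0`, needs no separate case, since `polarGauge_le_coe_iff` covers `r
  -- = 0`.
  have hs0 : 0 ≤ s := by
    have := hepi 0 1 (by simp [hκ.map_zero])
    simpa using this
  have := h y s ((polarGauge_le_coe_iff hκ).2 ⟨hs0, hepi⟩)
  rw [hgw] at hgx
  linarith

/-- The bipolar theorem for antipolar sets: a point of `C''` is a multiple `t • c` of a point of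
`C` with `t ≥ 1`. -/
theorem exists_smul_mem_of_mem_antipolar_antipolar {E : Type*} [NormedAddCommGroup E]
    [InnerProductSpace ℝ E] [CompleteSpace E] {C : Set E} (hcl : IsClosed C)
    (hconv : Convex ℝ C) (hzero : (0 : E) ∉ C) {x : E} (hx : x ∈ antipolar (antipolar C)) :
    ∃ t : ℝ, 0 < t ∧ t ≤ 1 ∧ t • x ∈ C := by
  by_contra! hcon
  have hdisj : Disjoint (segment ℝ 0 x) C := by
    rw [Set.disjoint_left]
    rintro _ hmem hC
    rw [segment_eq_image] at hmem
    obtain ⟨t, ⟨ht0, ht1⟩, rfl⟩ := hmem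
    simp only [smul_zero, zero_add] at hC
    rcases ht0.eq_or_lt with rfl | ht
    · exact hzero (by simpa using hC)
    · exact hcon t ht ht1 hC
  -- Separating the whole segment, and not just `x`, forces `0 < u < v`, so `f` can be normalised
  -- into the antipolar.
  obtain ⟨f, u, v, hu, huv, hv⟩ := geometric_hahn_banach_compact_closed
    (convex_segment (𝕜 := ℝ) 0 x) (by
      rw [segment_eq_image]
      exact isCompact_Icc.image (by fun_prop)) hconv hcl hdisj
  have hu0 : 0 < u := by simpa using hu 0 (left_mem_segment ℝ 0 x)
  have hv0 : 0 < v := hu0.trans huv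
  let y := (InnerProductSpace.toDual ℝ E).symm f
  have hy : ∀ w, (⟪y, w⟫ : ℝ) = f w := fun w => by simp [y]
  have hmem : v⁻¹ • y ∈ antipolar C := fun c hc => by
    rw [real_inner_smul_left, hy, inv_mul_eq_div, le_div_iff₀ hv0, one_mul]
    exact (hv c hc).le
  have h1 := hx _ hmem
  rw [real_inner_comm, real_inner_smul_left, hy, inv_mul_eq_div, le_div_iff₀ hv0] at h1
  linarith [hu x (right_mem_segment ℝ 0 x)]

theorem convex_antipolar {E : Type*} [NormedAddCommGroup E] [InnerProductSpace ℝ E] (C : Set E) :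
    Convex ℝ (antipolar C) := by
  intro y hy z hz a b ha hb hab x hx
  rw [inner_add_left, real_inner_smul_left, real_inner_smul_left]
  have h1 := mul_le_mul_of_nonneg_left (hy x hx) ha
  have h2 := mul_le_mul_of_nonneg_left (hz x hx) hb
  linarith

/-! ### Weak and strong duality -/

/-- Weak duality. -/
theorem one_le_mul_of_mem_antipolar {E : Type*} [NormedAddCommGroup E] [InnerProductSpace ℝ E]
    {κ : E → EReal} (hκ : IsGauge κ) {C : Set E} {x y : E} {m r : ℝ} (hx : x ∈ C)
    (hy : y ∈ antipolar C) (hm : κ x ≤ m) (hr : polarGauge κ y ≤ r) : 1 ≤ r * m := by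
  refine (hy x hx).trans ?_
  rw [real_inner_comm]
  exact ((polarGauge_le_coe_iff hκ).1 hr).2 x m hm

/-- `exists_inner_le_of_intrinsicInterior_inter` for a gauge. -/
theorem IsGauge.exists_inner_le {E : Type*} [NormedAddCommGroup E] [InnerProductSpace ℝ E]
    [FiniteDimensional ℝ E] {κ : E → EReal} (hκ : IsGauge κ) {C : Set E} (hC : Convex ℝ C)
    {v : ℝ} (hv : ∀ c ∈ C, ∀ μ : ℝ, κ c ≤ μ → v ≤ μ)
    (hri : (intrinsicInterior ℝ (effDomain κ) ∩ intrinsicInterior ℝ C).Nonempty) :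
    ∃ z : E, (∀ x : E, ∀ μ : ℝ, κ x ≤ μ → (⟪z, x⟫ : ℝ) ≤ μ) ∧ ∀ c ∈ C, v ≤ (⟪z, c⟫ : ℝ) := by
  refine exists_inner_le_of_intrinsicInterior_inter (K := hκ.epigraphCone) hC
    (fun μ h => hκ.nonneg_of_le h) hv ?_
  change (intrinsicInterior ℝ (Prod.fst '' epigraph κ) ∩ _).Nonempty
  rwa [image_fst_epigraph]

theorem optValue_eq_of_le {E : Type*} {f : E → EReal} {S : Set E} {v : ℝ} {x : E} (hx : x ∈ S)
    (hxv : f x ≤ v) (h : ∀ c ∈ S, ∀ μ : ℝ, f c ≤ μ → v ≤ μ) :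
    optValue f S = v ∧ IsAttained f S := by
  have hle : (v : EReal) ≤ optValue f S := le_iInf₂ fun c hc =>
    le_of_forall_real_le fun μ hμ => by exact_mod_cast h c hc μ hμ
  have hx' : optValue f S ≤ f x := iInf₂_le x hx
  exact ⟨le_antisymm (hx'.trans hxv) hle, x, hx, le_antisymm (hxv.trans hle) hx'⟩

theorem mainTheorem2 {E : Type*} [NormedAddCommGroup E] [InnerProductSpace ℝ E]
    [FiniteDimensional ℝ E] (κ : E → EReal) (C : Set E)
    (hκ : IsGauge κ) (hκ_closed : IsClosedFun κ)
    (hC_ne : C.Nonempty) (hC_closed : IsClosed C) (hC_convex : Convex ℝ C) (hC_zero : (0 : E) ∉ C)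
    (h_primal : (intrinsicInterior ℝ (effDomain κ) ∩ intrinsicInterior ℝ C).Nonempty)
    (h_dual : (intrinsicInterior ℝ (effDomain (polarGauge κ)) ∩
      intrinsicInterior ℝ (antipolar C)).Nonempty) :
    optValue κ C * optValue (polarGauge κ) (antipolar C) = 1 ∧
      IsAttained κ C ∧ IsAttained (polarGauge κ) (antipolar C) := by
  obtain ⟨a, haκ, haC⟩ := h_primal
  obtain ⟨b, hbκ, hbC⟩ := h_dual
  have haC' := intrinsicInterior_subset haC
  have hbC' := intrinsicInterior_subset hbC
  obtain ⟨m, ham, -⟩ := EReal.lt_iff_exists_real_btwn.1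
    (show a ∈ effDomain κ from intrinsicInterior_subset haκ)
  obtain ⟨r, hbr, -⟩ := EReal.lt_iff_exists_real_btwn.1
    (show b ∈ effDomain (polarGauge κ) from intrinsicInterior_subset hbκ)
  have hκ' := isGauge_polarGauge hκ
  obtain ⟨v, hv⟩ : ∃ v : ℝ, optValue κ C = v := by
    have h1 : optValue κ C ≤ m := (iInf₂_le a haC').trans ham.le
    have h2 : 0 ≤ optValue κ C := le_iInf₂ fun c _ => hκ.nonneg c
    refine ⟨(optValue κ C).toReal, (EReal.coe_toReal ?_ ?_).symm⟩
    · exact (h1.trans_lt (EReal.coe_lt_top m)).ne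
    · exact (EReal.bot_lt_zero.trans_le h2).ne'
  have hvC : ∀ c ∈ C, ∀ μ : ℝ, κ c ≤ μ → v ≤ μ := fun c hc μ hμ => by
    have : optValue κ C ≤ μ := (iInf₂_le c hc).trans hμ
    rw [hv] at this
    exact_mod_cast this
  have hlow : ∀ y ∈ antipolar C, ∀ s : ℝ, polarGauge κ y ≤ s → 0 < s ∧ s⁻¹ ≤ v := by
    intro y hy s hs
    have hs0 := hκ'.nonneg_of_le hs
    -- If `s = 0`, weak duality against the feasible point `a` would read `1 ≤ 0 * m`.
    have hspos : 0 < s := by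
      refine hs0.lt_of_ne ?_
      rintro rfl
      have := one_le_mul_of_mem_antipolar hκ haC' hy ham.le hs
      linarith
    have : ((s⁻¹ : ℝ) : EReal) ≤ optValue κ C := le_iInf₂ fun c hc =>
      le_of_forall_real_le fun μ hμ => by
        have := one_le_mul_of_mem_antipolar hκ hc hy hμ hs
        exact_mod_cast (inv_le_iff_one_le_mul₀' hspos).2 this
    rw [hv] at this
    exact ⟨hspos, by exact_mod_cast this⟩
  have hvpos : 0 < v := by
    obtain ⟨hr, hrv⟩ := hlow b hbC' r hbr.le
    exact (inv_pos.2 hr).trans_le hrv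
  have hlow' : ∀ y ∈ antipolar C, ∀ s : ℝ, polarGauge κ y ≤ s → v⁻¹ ≤ s := fun y hy s hs =>
    inv_le_of_inv_le₀ (hlow y hy s hs).1 (hlow y hy s hs).2
  obtain ⟨z, hz, hzC⟩ := hκ.exists_inner_le hC_convex hvC ⟨a, haκ, haC⟩
  obtain ⟨w, hw, hwC⟩ := hκ'.exists_inner_le (convex_antipolar C) hlow' ⟨b, hbκ, hbC⟩
  have hzmem : v⁻¹ • z ∈ antipolar C := fun c hc => by
    rw [real_inner_smul_left, inv_mul_eq_div, le_div_iff₀ hvpos, one_mul]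
    exact hzC c hc
  have hzle : polarGauge κ (v⁻¹ • z) ≤ (v⁻¹ : ℝ) := by
    refine (polarGauge_le_coe_iff hκ).2 ⟨by positivity, fun x μ hx => ?_⟩
    rw [real_inner_comm, real_inner_smul_left]
    exact mul_le_mul_of_nonneg_left (hz x μ hx) (by positivity)
  obtain ⟨hvg, hattg⟩ := optValue_eq_of_le hzmem hzle hlow'
  have hwle : κ (v • w) ≤ v := by
    refine le_of_forall_inner_le_polarGauge hκ hκ_closed fun y s hs => ?_
    rw [real_inner_smul_left]
    exact mul_le_mul_of_nonneg_left (hw y s hs) hvpos.le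
  have hwmem : v • w ∈ antipolar (antipolar C) := fun y hy => by
    rw [real_inner_smul_left, ← inv_le_iff_one_le_mul₀' hvpos]
    exact hwC y hy
  obtain ⟨t, ht0, ht1, htC⟩ :=
    exists_smul_mem_of_mem_antipolar_antipolar hC_closed hC_convex hC_zero hwmem
  have htle : κ (t • v • w) ≤ v := by
    have h1 : κ (t • v • w) ≤ (t * v : ℝ) :=
      hκ.smul_mem_epigraph (p := (v • w, v)) ht0.le hwle
    refine h1.trans ?_
    exact_mod_cast mul_le_of_le_one_left hvpos.le ht1
  refine ⟨?_, (optValue_eq_of_le htC htle hvC).2, hattg⟩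
  rw [hv, hvg, ← EReal.coe_mul, mul_inv_cancel₀ hvpos.ne', EReal.coe_one]
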